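/- Let $G$ be a locally compact Polish abelian group (written additively) with Haar measure $\lambda$. If a $G$-valued random variable $X$ has a density $f$ with respect to $\lambda$, its entropy is $h(X)=-\int_G f\log f\,d\lambda$, where $\log$ is the natural logarithm and $0\log 0=0$. For $G$-valued random variables $X,Y$ put $d_R(X\|Y)=h(X'-Y')-h(X')$, where $X',Y'$ are independent and distributed as $X$ and $Y$, respectively. In each inequality below, all entropies and divergences that appear, as well as those entering the definitions of the divergences, are assumed to be well-defined (that is, the density exists and the integral exists) and finite. 1. Let $X,Y$ be independent $G$-valued random variables and let $a,b$ be integers. Then $$h(aX+bY)-h(X+Y)\le \tau_{a,b}\,\bigl(d_R(X\|-Y)+d_R(Y\|-X)\bigr),\qquad \tau_{a,b}=6\bigl(\lfloor\log|a|\rfloor+\lfloor\log|b|\rfloor+2\bigr),$$ where $\lfloor\log|0|\rfloor$ is read as $0$. 2. Let $X,X',Z$ be independent $G$-valued random variables, where $X'$ has the same distribution as $X$, and let $a,b$ be nonzero integers. Then $$h(aX+Z)\le h\bigl((a-b)X+bX'+Z\bigr)+d_R(X\|X),$$ and, if $a$ is even, $$h(aX+Z)\le h\bigl(\tfrac a2X+Z\bigr)+h(2X-X')-h(X).$$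 -/

import Mathlib

open MeasureTheory ProbabilityTheory

noncomputable section

/-- The density `dP_X/dlam` of a `G`-valued random variable `X` with respect to `lam`, as a
real-valued function. It is meaningful when the law of `X` is absolutely continuous
with respect to `lam`. -/
def haarDensity {G Ω : Type*} [MeasurableSpace G] [MeasurableSpace Ω]
    (lam : Measure G) (P : Measure Ω) (X : Ω → G) (x : G) : ℝ :=
  ((P.map X).rnDeriv lam x).toReal

/-- The entropy `h(X) = - ∫ f log f dlam`, where `f` is the density of `X` with respect to
`lam` (natural logarithm, `0 log 0 = 0`). -/
def haarEntropy {G Ω : Type*} [MeasurableSpace G] [MeasurableSpace Ω]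
    (lam : Measure G) (P : Measure Ω) (X : Ω → G) : ℝ :=
  - ∫ x, haarDensity lam P X x * Real.log (haarDensity lam P X x) ∂lam

/-- The entropy of `X` is well-defined and finite: `X` has a density `f` with respect to `lam`,
and `f log f` is integrable. -/
structure HasFiniteHaarEntropy {G Ω : Type*} [MeasurableSpace G] [MeasurableSpace Ω]
    (lam : Measure G) (P : Measure Ω) (X : Ω → G) : Prop where
  absolutelyContinuous : P.map X ≪ lam
  integrable : Integrable
    (fun x => haarDensity lam P X x * Real.log (haarDensity lam P X x)) lam

/-- The Ruzsa divergence `d_R(X‖Y) = h(X' - Y') - h(X)`, where `X'`, `Y'` are independent with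
the same distributions as `X`, `Y`; they are realised as the two coordinates on `G × G` under
the product of the laws of `X` and `Y`. -/
def ruzsaDivergence {G Ω : Type*} [AddCommGroup G] [MeasurableSpace G] [MeasurableSpace Ω]
    (lam : Measure G) (P : Measure Ω) (X Y : Ω → G) : ℝ :=
  haarEntropy lam ((P.map X).prod (P.map Y)) (fun p : G × G => p.1 - p.2)
    - haarEntropy lam P X

end

open scoped ENNReal

/-! ### Gibbs' inequality in exponential form. -/

section Gibbs

variable {Ω : Type*} [MeasurableSpace Ω] {π : Measure Ω} {A B : Ω → ℝ}

/-! Every entropy inequality comes from Gibbs' inequality: if a ratio of densities, evaluated along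
a coupling, has mean at most one, then the mean of its logarithm is at most zero. The mean is
bounded by Tonelli and translation invariance of `lam`.

This yields three inequalities for independent summands: monotonicity `h(X) ≤ h(X + W)`,
submodularity (`lawEntropy_conv_conv_add_le`), and `h((mc + r)A + C) + h(M) ≤ h(mA - M) + h(rA + cM
+ C)` (`lawEntropy_dilate_conv_add_le`). The last one with `(m, c, r) = (1, b, a - b)` and `(2, a/2,
0)` is the second half of the theorem.

For the first half put `D = 2h(X + Y) - h(X) - h(Y)`, the sum of the two divergences. Then `h(X ±
X') - h(X) ≤ D` and `h(2X - X') - h(X) ≤ 3D`. Writing `a = 2c + r` with a binary digit `r`, a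
doubling costs `3D` and a digit `D`, so adding `aX` to a sum already containing a copy of `X` costs
at most `(4k + 1)D` with `k = ⌊log₂|a|⌋`. Adding `aX` and `bY` to `X' + Y'` and dropping `X' + Y'`
by monotonicity gives the bound.

The intermediate entropies are not assumed finite. Smoothing by a law of finite entropy excludes
`-∞` (`LowerLawEntropy`), and the exponential bound then excludes `+∞`. -/

theorem integrable_exp_of_lintegral_le_one (hA : AEStronglyMeasurable A π)
    (h : ∫⁻ ω, ENNReal.ofReal (Real.exp (A ω)) ∂π ≤ 1) :
    Integrable (fun ω => Real.exp (A ω)) π := by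
  refine ⟨Real.continuous_exp.comp_aestronglyMeasurable hA, ?_⟩
  rw [hasFiniteIntegral_iff_ofReal (Filter.Eventually.of_forall fun ω => (Real.exp_pos _).le)]
  exact h.trans_lt ENNReal.one_lt_top

/-- If `exp (A - B)` has integral at most one and `A` is integrable, then so is the negative part
of `B`. -/
theorem integrable_negPart_of_lintegral_exp_sub_le_one (hA : Integrable A π)
    (hB : AEStronglyMeasurable B π)
    (h : ∫⁻ ω, ENNReal.ofReal (Real.exp (A ω - B ω)) ∂π ≤ 1) :
    Integrable (fun ω => max (-B ω) 0) π := by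
  have hexp := integrable_exp_of_lintegral_le_one (A := fun ω => A ω - B ω)
    (hA.aestronglyMeasurable.sub hB) h
  refine (hexp.add hA.abs).mono' (hB.neg.sup aestronglyMeasurable_const)
    (Filter.Eventually.of_forall fun ω => ?_)
  -- The domination is `B⁻ ≤ exp (A - B) + |A|`, from `t + 1 ≤ exp t`.
  have h1 := Real.add_one_le_exp (A ω - B ω)
  have h2 := neg_abs_le (A ω)
  have h3 := Real.exp_pos (A ω - B ω)
  have h4 := abs_nonneg (A ω)
  have h5 := le_abs_self (A ω)
  simp only [Pi.add_apply]
  rw [Real.norm_of_nonneg (le_max_right _ _)]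
  exact max_le (by linarith) (by linarith)

/-- Gibbs' inequality: if `exp (A - B)` has mean at most one, then the mean of `A` is at most
that of `B`. -/
theorem integral_le_integral_of_lintegral_exp_sub_le_one [IsProbabilityMeasure π]
    (hA : Integrable A π) (hB : Integrable B π)
    (h : ∫⁻ ω, ENNReal.ofReal (Real.exp (A ω - B ω)) ∂π ≤ 1) :
    ∫ ω, A ω ∂π ≤ ∫ ω, B ω ∂π := by
  have hexp := integrable_exp_of_lintegral_le_one (A := fun ω => A ω - B ω)
    (hA.aestronglyMeasurable.sub hB.aestronglyMeasurable) h
  have hAB : Integrable (fun ω => A ω - B ω) π := hA.sub hB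
  have hle : ∫ ω, Real.exp (A ω - B ω) ∂π ≤ 1 := by
    rw [integral_eq_lintegral_of_nonneg_ae
      (Filter.Eventually.of_forall fun ω => (Real.exp_pos _).le) hexp.aestronglyMeasurable]
    exact ENNReal.toReal_mono ENNReal.one_ne_top h
  have hmono : ∫ ω, (A ω - B ω + 1) ∂π ≤ ∫ ω, Real.exp (A ω - B ω) ∂π :=
    integral_mono (hAB.add (integrable_const 1)) hexp
      fun ω => Real.add_one_le_exp _
  rw [integral_add hAB (integrable_const 1), integral_sub hA hB] at hmono
  simp only [integral_const, probReal_univ, smul_eq_mul, mul_one] at hmono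
  linarith

end Gibbs

/-- The differential entropy of a law `μ` relative to `lam`. -/
noncomputable def lawEntropy {G : Type*} [MeasurableSpace G] (lam μ : Measure G) : ℝ :=
  -∫ x, llr μ lam x ∂μ

/-- The law `μ` has a density and a finite entropy relative to `lam`. -/
structure FiniteLawEntropy {G : Type*} [MeasurableSpace G] (lam μ : Measure G) : Prop where
  ac : μ ≪ lam
  integrable : Integrable (llr μ lam) μ

/-- The law `μ` has a density relative to `lam`, and its entropy is well-defined as an element of
`(-∞, ∞]`. -/
structure LowerLawEntropy {G : Type*} [MeasurableSpace G] (lam μ : Measure G) : Prop where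
  ac : μ ≪ lam
  integrable : Integrable (fun x => max (llr μ lam x) 0) μ

/-! ### From means of density ratios to entropy inequalities. -/

section Transfer

variable {G Ω : Type*} [MeasurableSpace G] [MeasurableSpace Ω] {lam : Measure G}

theorem FiniteLawEntropy.lower {μ : Measure G} (h : FiniteLawEntropy lam μ) :
    LowerLawEntropy lam μ :=
  ⟨h.ac, h.integrable.pos_part⟩

theorem LowerLawEntropy.finite {μ : Measure G} (h : LowerLawEntropy lam μ)
    (hn : Integrable (fun x => max (-llr μ lam x) 0) μ) : FiniteLawEntropy lam μ := by
  refine ⟨h.ac, (h.integrable.sub hn).congr (Filter.Eventually.of_forall fun x => ?_)⟩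
  simp only [Pi.sub_apply]
  rcases le_total (llr μ lam x) 0 with h0 | h0
  · rw [max_eq_right h0, max_eq_left (by linarith)]; ring
  · rw [max_eq_left h0, max_eq_right (by linarith)]; ring

theorem hasFiniteHaarEntropy_iff [SigmaFinite lam] {P : Measure Ω} [IsProbabilityMeasure P]
    {X : Ω → G} :
    HasFiniteHaarEntropy lam P X ↔ FiniteLawEntropy lam (P.map X) := by
  constructor
  · rintro ⟨h1, h2⟩
    exact ⟨h1, (integrable_rnDeriv_mul_log_iff h1).1 h2⟩
  · rintro ⟨h1, h2⟩
    exact ⟨h1, (integrable_rnDeriv_mul_log_iff h1).2 h2⟩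

theorem haarEntropy_eq_lawEntropy [SigmaFinite lam] {P : Measure Ω} [IsProbabilityMeasure P]
    {X : Ω → G} (h : P.map X ≪ lam) :
    haarEntropy lam P X = lawEntropy lam (P.map X) := by
  unfold haarEntropy lawEntropy haarDensity
  rw [integral_rnDeriv_mul_log h]

/-- The density is positive and finite almost everywhere for `μ` itself, so the truncations hidden
in `toReal` and `log` do no harm. -/
theorem ae_ofReal_exp_llr [SigmaFinite lam] {μ : Measure G} [IsProbabilityMeasure μ]
    (h : μ ≪ lam) :
    ∀ᵐ x ∂μ, ENNReal.ofReal (Real.exp (llr μ lam x)) = μ.rnDeriv lam x ∧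
      ENNReal.ofReal (Real.exp (-llr μ lam x)) = (μ.rnDeriv lam x)⁻¹ := by
  filter_upwards [Measure.rnDeriv_pos h, h.ae_le (Measure.rnDeriv_lt_top μ lam)] with x h0 h1
  have hpos : 0 < (μ.rnDeriv lam x).toReal := ENNReal.toReal_pos h0.ne' h1.ne
  constructor
  · rw [llr, Real.exp_log hpos, ENNReal.ofReal_toReal h1.ne]
  · rw [llr, Real.exp_neg, Real.exp_log hpos, ENNReal.ofReal_inv_of_pos hpos,
      ENNReal.ofReal_toReal h1.ne]

variable {π : Measure Ω}

theorem integrable_llr_comp {T : Ω → G} (hT : Measurable T)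
    (h : Integrable (llr (π.map T) lam) (π.map T)) :
    Integrable (fun ω => llr (π.map T) lam (T ω)) π :=
  (integrable_map_measure h.aestronglyMeasurable hT.aemeasurable).1 h

theorem integral_llr_comp {T : Ω → G} (hT : Measurable T) :
    ∫ ω, llr (π.map T) lam (T ω) ∂π = -lawEntropy lam (π.map T) := by
  rw [lawEntropy, neg_neg, integral_map hT.aemeasurable
    (measurable_llr _ _).aestronglyMeasurable]

/-- If a ratio of two densities of `T` and `X` has mean at most one, then `T` has more entropy
than `X`. -/
theorem entropy_le_of_lintegral_ratio_le_one [SigmaFinite lam] [IsProbabilityMeasure π]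
    {T X : Ω → G} (hT : Measurable T) (hX : Measurable X)
    (hTac : π.map T ≪ lam) (hXac : π.map X ≪ lam)
    (h : ∫⁻ ω, (π.map T).rnDeriv lam (T ω) * ((π.map X).rnDeriv lam (X ω))⁻¹ ∂π ≤ 1) :
    (FiniteLawEntropy lam (π.map X) → LowerLawEntropy lam (π.map T)) ∧
    (FiniteLawEntropy lam (π.map T) → LowerLawEntropy lam (π.map X) →
      FiniteLawEntropy lam (π.map X)) ∧
    (FiniteLawEntropy lam (π.map T) → FiniteLawEntropy lam (π.map X) →
      lawEntropy lam (π.map X) ≤ lawEntropy lam (π.map T)) := by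
  have := Measure.isProbabilityMeasure_map (μ := π) hT.aemeasurable
  have := Measure.isProbabilityMeasure_map (μ := π) hX.aemeasurable
  have hexp : ∫⁻ ω, ENNReal.ofReal (Real.exp
      (llr (π.map T) lam (T ω) - llr (π.map X) lam (X ω))) ∂π ≤ 1 := by
    refine le_of_eq_of_le (lintegral_congr_ae ?_) h
    filter_upwards [ae_of_ae_map hT.aemeasurable (ae_ofReal_exp_llr hTac),
      ae_of_ae_map hX.aemeasurable (ae_ofReal_exp_llr hXac)] with ω h1 h2
    rw [sub_eq_add_neg, Real.exp_add, ENNReal.ofReal_mul (Real.exp_pos _).le, h1.1, h2.2]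
  have mT : Measurable fun ω => llr (π.map T) lam (T ω) := (measurable_llr _ _).comp hT
  have mX : Measurable fun ω => llr (π.map X) lam (X ω) := (measurable_llr _ _).comp hX
  refine ⟨fun hXf => ⟨hTac, ?_⟩, fun hTf hXl => hXl.finite ?_, fun hTf hXf => ?_⟩
  · rw [integrable_map_measure ((measurable_llr _ _).max measurable_const).aestronglyMeasurable
      hT.aemeasurable]
    -- With both signs reversed the difference is unchanged, and the negative part becomes the
    -- positive part of the log-density of `T`.
    have := integrable_negPart_of_lintegral_exp_sub_le_one
      (A := fun ω => -llr (π.map X) lam (X ω)) (B := fun ω => -llr (π.map T) lam (T ω))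
      (integrable_llr_comp hX hXf.integrable).neg mT.neg.aestronglyMeasurable
      (by simpa only [neg_sub_neg] using hexp)
    simpa only [neg_neg, Function.comp_def] using this
  · refine (integrable_map_measure
      ((measurable_llr _ _).neg.max measurable_const).aestronglyMeasurable hX.aemeasurable).2 ?_
    exact integrable_negPart_of_lintegral_exp_sub_le_one
      (integrable_llr_comp hT hTf.integrable) mX.aestronglyMeasurable hexp
  · have := integral_le_integral_of_lintegral_exp_sub_le_one
      (integrable_llr_comp hT hTf.integrable) (integrable_llr_comp hX hXf.integrable) hexp
    rw [integral_llr_comp hT, integral_llr_comp hX] at this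
    linarith

/-- If the ratio of the densities of `S`, `V` to those of `X`, `T` has mean at most one, then
`h(T) + h(X) ≤ h(S) + h(V)`. -/
theorem entropy_add_le_of_lintegral_ratio_le_one [SigmaFinite lam] [IsProbabilityMeasure π]
    {S V X T : Ω → G} (hS : Measurable S) (hV : Measurable V) (hX : Measurable X)
    (hT : Measurable T) (hSf : FiniteLawEntropy lam (π.map S))
    (hVf : FiniteLawEntropy lam (π.map V)) (hXf : FiniteLawEntropy lam (π.map X))
    (hTl : LowerLawEntropy lam (π.map T))
    (h : ∫⁻ ω, (π.map S).rnDeriv lam (S ω) * (π.map V).rnDeriv lam (V ω) *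
      ((π.map X).rnDeriv lam (X ω))⁻¹ * ((π.map T).rnDeriv lam (T ω))⁻¹ ∂π ≤ 1) :
    FiniteLawEntropy lam (π.map T) ∧
      lawEntropy lam (π.map T) + lawEntropy lam (π.map X) ≤
        lawEntropy lam (π.map S) + lawEntropy lam (π.map V) := by
  have := Measure.isProbabilityMeasure_map (μ := π) hT.aemeasurable
  have := Measure.isProbabilityMeasure_map (μ := π) hX.aemeasurable
  have := Measure.isProbabilityMeasure_map (μ := π) hS.aemeasurable
  have := Measure.isProbabilityMeasure_map (μ := π) hV.aemeasurable
  have hexp : ∫⁻ ω, ENNReal.ofReal (Real.exp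
      ((llr (π.map S) lam (S ω) + llr (π.map V) lam (V ω) - llr (π.map X) lam (X ω))
        - llr (π.map T) lam (T ω))) ∂π ≤ 1 := by
    refine le_of_eq_of_le (lintegral_congr_ae ?_) h
    filter_upwards [ae_of_ae_map hT.aemeasurable (ae_ofReal_exp_llr hTl.ac),
      ae_of_ae_map hX.aemeasurable (ae_ofReal_exp_llr hXf.ac),
      ae_of_ae_map hS.aemeasurable (ae_ofReal_exp_llr hSf.ac),
      ae_of_ae_map hV.aemeasurable (ae_ofReal_exp_llr hVf.ac)] with ω h1 h2 h3 h4
    rw [sub_eq_add_neg, sub_eq_add_neg, Real.exp_add, Real.exp_add, Real.exp_add,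
      ENNReal.ofReal_mul (by positivity), ENNReal.ofReal_mul (by positivity),
      ENNReal.ofReal_mul (by positivity), h1.2, h2.2, h3.1, h4.1]
  have mT : Measurable fun ω => llr (π.map T) lam (T ω) := (measurable_llr _ _).comp hT
  have iS := integrable_llr_comp hS hSf.integrable
  have iV := integrable_llr_comp hV hVf.integrable
  have iX := integrable_llr_comp hX hXf.integrable
  have iSV : Integrable (fun ω => llr (π.map S) lam (S ω) + llr (π.map V) lam (V ω)) π :=
    iS.add iV
  have hTf : FiniteLawEntropy lam (π.map T) := by
    refine hTl.finite ?_
    refine (integrable_map_measure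
      ((measurable_llr _ _).neg.max measurable_const).aestronglyMeasurable hT.aemeasurable).2 ?_
    exact integrable_negPart_of_lintegral_exp_sub_le_one (iSV.sub iX)
      mT.aestronglyMeasurable hexp
  refine ⟨hTf, ?_⟩
  have := integral_le_integral_of_lintegral_exp_sub_le_one (iSV.sub iX)
    (integrable_llr_comp hT hTf.integrable) hexp
  simp only [Pi.sub_apply] at this
  rw [integral_sub iSV iX, integral_add iS iV, integral_llr_comp hT,
    integral_llr_comp hX, integral_llr_comp hS, integral_llr_comp hV] at this
  linarith

end Transfer

/-- The law of `n • X` when `X` has law `μ`. -/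
noncomputable def dilate {G : Type*} [AddCommGroup G] [MeasurableSpace G] (n : ℤ)
    (μ : Measure G) : Measure G :=
  μ.map fun x => n • x

/-! ### Cancelling a density against its own law. -/

section Density

variable {G : Type*} [MeasurableSpace G] {lam μ : Measure G}

/-- Only an inequality: `f * f⁻¹` is `0`, not `1`, where `f` is `0` or `∞`. -/
theorem lintegral_mul_inv_rnDeriv_le [SigmaFinite lam] [IsProbabilityMeasure μ] (h : μ ≪ lam)
    {F : G → ℝ≥0∞} (hF : Measurable F) :
    ∫⁻ x, F x * (μ.rnDeriv lam x)⁻¹ ∂μ ≤ ∫⁻ x, F x ∂lam := by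
  rw [← lintegral_rnDeriv_mul h (by fun_prop)]
  refine lintegral_mono fun x => ?_
  calc μ.rnDeriv lam x * (F x * (μ.rnDeriv lam x)⁻¹)
      = F x * (μ.rnDeriv lam x * (μ.rnDeriv lam x)⁻¹) := by ring
    _ ≤ F x * 1 := by gcongr; exact ENNReal.mul_inv_le_one _
    _ = F x := mul_one _

theorem lintegral_rnDeriv_le_one [IsProbabilityMeasure μ] :
    ∫⁻ x, μ.rnDeriv lam x ∂lam ≤ 1 :=
  Measure.lintegral_rnDeriv_le.trans_eq measure_univ

end Density

section Dilate

variable {G : Type*} [AddCommGroup G] [MeasurableSpace G]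

theorem dilate_zero (μ : Measure G) [IsProbabilityMeasure μ] :
    dilate 0 μ = Measure.dirac 0 := by
  simp [dilate]

theorem dilate_one (μ : Measure G) : dilate 1 μ = μ := by
  simp [dilate]

theorem lawEntropy_dilate_neg_one {G : Type*} [AddCommGroup G] [MeasurableSpace G]
    [MeasurableNeg G] {lam : Measure G} [SigmaFinite lam] [lam.IsNegInvariant] {μ : Measure G} [IsProbabilityMeasure μ]
    (h : FiniteLawEntropy lam μ) :
    FiniteLawEntropy lam (dilate (-1) μ) ∧ lawEntropy lam (dilate (-1) μ) = lawEntropy lam μ := by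
  have hneg : dilate (-1) μ = μ.map Neg.neg := by simp only [dilate, neg_smul, one_smul]
  have he : MeasurableEmbedding (Neg.neg : G → G) := (MeasurableEquiv.neg G).measurableEmbedding
  have hlam : lam.map (Neg.neg : G → G) = lam := Measure.map_neg_eq_self lam
  have hll : ∀ᵐ x ∂μ, llr (μ.map Neg.neg) lam (-x) = llr μ lam x := by
    have := he.rnDeriv_map μ lam
    rw [hlam] at this
    filter_upwards [h.ac.ae_le this] with x hx
    rw [llr, llr, hx]
  rw [hneg]
  refine ⟨⟨?_, ?_⟩, ?_⟩
  · have := h.ac.map (measurable_neg (G := G))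
    rwa [hlam] at this
  · rw [he.integrable_map_iff]
    exact h.integrable.congr (hll.mono fun x hx => hx.symm)
  · rw [lawEntropy, he.integral_map, integral_congr_ae hll, lawEntropy]

end Dilate

/-! ### Monotonicity of entropy under independent sums. -/

section Convolution

variable {G : Type*} [AddCommGroup G] [MeasurableSpace G] [MeasurableAdd₂ G]
  {lam : Measure G} [SigmaFinite lam] [lam.IsAddLeftInvariant]

/-- For fixed `w`, integrating `f_{μ∗ζ}(w + x) / f_μ(x)` over `μ` cancels `f_μ` and leaves a
translate of a density, of mass at most one. -/
theorem entropy_conv {μ ζ : Measure G} [IsProbabilityMeasure μ] [IsProbabilityMeasure ζ]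
    (hac : μ ∗ ζ ≪ lam) (hμ : μ ≪ lam) :
    (FiniteLawEntropy lam μ → LowerLawEntropy lam (μ ∗ ζ)) ∧
    (FiniteLawEntropy lam (μ ∗ ζ) → LowerLawEntropy lam μ → FiniteLawEntropy lam μ) ∧
    (FiniteLawEntropy lam (μ ∗ ζ) → FiniteLawEntropy lam μ →
      lawEntropy lam μ ≤ lawEntropy lam (μ ∗ ζ)) := by
  have hX : (ζ.prod μ).map Prod.snd = μ := by simp
  have hT : (ζ.prod μ).map (fun p => p.1 + p.2) = μ ∗ ζ := by
    rw [Measure.conv_comm]; rfl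
  have key := entropy_le_of_lintegral_ratio_le_one (lam := lam) (π := ζ.prod μ)
    (T := fun p => p.1 + p.2) (X := Prod.snd) (by fun_prop) (by fun_prop)
  rw [hX, hT] at key
  refine key hac hμ ?_
  rw [lintegral_prod _ (by fun_prop)]
  calc ∫⁻ w, ∫⁻ x, (μ ∗ ζ).rnDeriv lam (w + x) * (μ.rnDeriv lam x)⁻¹ ∂μ ∂ζ
      ≤ ∫⁻ w, 1 ∂ζ := by
        refine lintegral_mono fun w => ?_
        refine (lintegral_mul_inv_rnDeriv_le hμ (by fun_prop)).trans ?_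
        rw [lintegral_add_left_eq_self]
        exact lintegral_rnDeriv_le_one
    _ = 1 := by simp

theorem FiniteLawEntropy.lower_conv {μ : Measure G} [IsProbabilityMeasure μ]
    (h : FiniteLawEntropy lam μ) (ζ : Measure G) [IsProbabilityMeasure ζ] :
    LowerLawEntropy lam (μ ∗ ζ) := by
  refine (entropy_conv ?_ h.ac).1 h
  rw [Measure.conv_comm]
  exact Measure.conv_absolutelyContinuous h.ac

theorem LowerLawEntropy.finite_of_conv {μ ζ : Measure G} [IsProbabilityMeasure μ]
    [IsProbabilityMeasure ζ] (h : LowerLawEntropy lam μ) (hc : FiniteLawEntropy lam (μ ∗ ζ)) :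
    FiniteLawEntropy lam μ :=
  (entropy_conv hc.ac h.ac).2.1 hc h

theorem lawEntropy_le_conv {μ ζ : Measure G} [IsProbabilityMeasure μ]
    [IsProbabilityMeasure ζ] (h : FiniteLawEntropy lam μ) (hc : FiniteLawEntropy lam (μ ∗ ζ)) :
    lawEntropy lam μ ≤ lawEntropy lam (μ ∗ ζ) :=
  (entropy_conv hc.ac h.ac).2.2 hc h

end Convolution

/-! ### The two inequalities for three independent variables. -/

section Group

variable {G : Type*} [AddCommGroup G] [MeasurableSpace G] [MeasurableAdd₂ G] [MeasurableNeg G]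

instance dilate.instIsProbabilityMeasure (n : ℤ) (μ : Measure G) [IsProbabilityMeasure μ] :
    IsProbabilityMeasure (dilate n μ) :=
  Measure.isProbabilityMeasure_map (by fun_prop)

theorem dilate_dilate (m n : ℤ) (μ : Measure G) : dilate m (dilate n μ) = dilate (m * n) μ := by
  unfold dilate
  rw [Measure.map_map (by fun_prop) (by fun_prop)]
  simp only [Function.comp_def, mul_smul]

theorem dilate_conv (n : ℤ) (μ ν : Measure G) [IsProbabilityMeasure μ] [IsProbabilityMeasure ν] :
    dilate n (μ ∗ ν) = dilate n μ ∗ dilate n ν := by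
  refine Measure.ext_of_lintegral _ fun f hf => ?_
  unfold dilate
  rw [lintegral_map hf (by fun_prop), Measure.lintegral_conv (by fun_prop),
    Measure.lintegral_conv hf, lintegral_map (by fun_prop) (by fun_prop)]
  refine lintegral_congr fun x => ?_
  rw [lintegral_map (by fun_prop) (by fun_prop)]
  simp only [smul_add]

variable {lam : Measure G} [SigmaFinite lam] [lam.IsAddLeftInvariant]

/-- The density of a sum is the average of the translates of one summand's density; submodularity
uses this to integrate out a variable. -/
theorem rnDeriv_conv_ae_eq (α : Measure G) {β : Measure G} [IsProbabilityMeasure α]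
    [IsProbabilityMeasure β] (h : β ≪ lam) :
    (α ∗ β).rnDeriv lam =ᵐ[lam] fun t => ∫⁻ a, β.rnDeriv lam (t - a) ∂α := by
  have hm : Measurable fun t => ∫⁻ a, β.rnDeriv lam (t - a) ∂α :=
    Measurable.lintegral_prod_right' (f := fun p : G × G => β.rnDeriv lam (p.1 - p.2))
      (by fun_prop)
  have : α ∗ β = lam.withDensity fun t => ∫⁻ a, β.rnDeriv lam (t - a) ∂α := by
    refine Measure.ext_of_lintegral _ fun f hf => ?_
    rw [Measure.lintegral_conv hf, lintegral_withDensity_eq_lintegral_mul _ hm hf]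
    simp only [Pi.mul_apply]
    calc ∫⁻ a, ∫⁻ b, f (a + b) ∂β ∂α
        = ∫⁻ a, ∫⁻ t, β.rnDeriv lam (t - a) * f t ∂lam ∂α := by
          refine lintegral_congr fun a => ?_
          rw [← lintegral_rnDeriv_mul h (by fun_prop), ← lintegral_sub_right_eq_self _ a]
          simp
      _ = ∫⁻ t, ∫⁻ a, β.rnDeriv lam (t - a) * f t ∂α ∂lam :=
          lintegral_lintegral_swap (by fun_prop)
      _ = _ := lintegral_congr fun t => lintegral_mul_const _ (by fun_prop)
  rw [this]
  exact Measure.rnDeriv_withDensity _ hm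

/-- Submodularity of the entropy of sums: `h(A + B + C) + h(B) ≤ h(A + B) + h(B + C)`. -/
theorem lawEntropy_conv_conv_add_le (A B C : Measure G) [IsProbabilityMeasure A]
    [IsProbabilityMeasure B] [IsProbabilityMeasure C] (hB : FiniteLawEntropy lam B)
    (hAB : FiniteLawEntropy lam (A ∗ B)) (hBC : FiniteLawEntropy lam (B ∗ C)) :
    FiniteLawEntropy lam (A ∗ B ∗ C) ∧
      lawEntropy lam (A ∗ B ∗ C) + lawEntropy lam B ≤
        lawEntropy lam (A ∗ B) + lawEntropy lam (B ∗ C) := by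
  have hT : LowerLawEntropy lam (A ∗ B ∗ C) := by
    rw [Measure.conv_comm A, Measure.conv_assoc]
    exact hB.lower_conv _
  have eX : (A.prod (C.prod B)).map (fun p => p.2.2) = B := by
    refine Measure.ext_of_lintegral _ fun f hf => ?_
    rw [lintegral_map hf (by fun_prop), lintegral_prod _ (by fun_prop)]
    simp_rw [lintegral_prod (μ := C) (ν := B) _
      (by fun_prop : AEMeasurable (fun q : G × G => f q.2) _)]
    simp
  have eS : (A.prod (C.prod B)).map (fun p => p.1 + p.2.2) = A ∗ B := by
    refine Measure.ext_of_lintegral _ fun f hf => ?_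
    rw [lintegral_map hf (by fun_prop), lintegral_prod _ (by fun_prop),
      Measure.lintegral_conv hf]
    refine lintegral_congr fun a => ?_
    rw [lintegral_prod _ (by fun_prop)]
    simp
  have eV : (A.prod (C.prod B)).map (fun p => p.2.2 + p.2.1) = B ∗ C := by
    refine Measure.ext_of_lintegral _ fun f hf => ?_
    rw [lintegral_map hf (by fun_prop), lintegral_prod _ (by fun_prop),
      Measure.lintegral_conv hf]
    simp only [lintegral_const, measure_univ, mul_one]
    rw [lintegral_prod_symm _ (by fun_prop)]
  have eT : (A.prod (C.prod B)).map (fun p => p.1 + (p.2.2 + p.2.1)) = A ∗ B ∗ C := by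
    refine Measure.ext_of_lintegral _ fun f hf => ?_
    rw [lintegral_map hf (by fun_prop), lintegral_prod _ (by fun_prop),
      Measure.lintegral_conv hf]
    refine lintegral_congr fun a => ?_
    rw [lintegral_prod_symm _ (by fun_prop), Measure.lintegral_conv (by fun_prop)]
  have key := entropy_add_le_of_lintegral_ratio_le_one (lam := lam) (π := A.prod (C.prod B))
    (S := fun p => p.1 + p.2.2) (V := fun p => p.2.2 + p.2.1)
    (X := fun p => p.2.2) (T := fun p => p.1 + (p.2.2 + p.2.1))
    (by fun_prop) (by fun_prop) (by fun_prop) (by fun_prop)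
  rw [eS, eV, eX, eT] at key
  refine key hAB hBC hB hT ?_
  -- Integrating `σ(t - c)` over `C` gives the density of `A ∗ B ∗ C`, which cancels the
  -- denominator.
  have d2 := rnDeriv_conv_ae_eq C hAB.ac
  rw [Measure.conv_comm C, Measure.conv_assoc] at d2
  set σ := A ∗ B
  set ρ := B ∗ C
  set τ := A ∗ ρ
  have hτ : IsProbabilityMeasure τ := inferInstance
  have hmain : ∀ a c : G, ∫⁻ b, σ.rnDeriv lam (a + b) * ρ.rnDeriv lam (b + c) *
      (B.rnDeriv lam b)⁻¹ * (τ.rnDeriv lam (a + (b + c)))⁻¹ ∂B ≤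
      ∫⁻ t, σ.rnDeriv lam (t - c) * ρ.rnDeriv lam (t - a) * (τ.rnDeriv lam t)⁻¹ ∂lam := by
    intro a c
    rw [← lintegral_add_right_eq_self (μ := lam) _ (a + c)]
    refine le_trans (le_of_eq ?_) (lintegral_mul_inv_rnDeriv_le hB.ac (by fun_prop))
    refine lintegral_congr fun b => ?_
    rw [show b + (a + c) - c = a + b by abel, show b + (a + c) - a = b + c by abel,
      show b + (a + c) = a + (b + c) by abel]
    ring
  calc _ = ∫⁻ a, ∫⁻ c, ∫⁻ b, σ.rnDeriv lam (a + b) * ρ.rnDeriv lam (b + c) *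
      (B.rnDeriv lam b)⁻¹ * (τ.rnDeriv lam (a + (b + c)))⁻¹ ∂B ∂C ∂A := by
        rw [lintegral_prod _ (by fun_prop)]
        refine lintegral_congr fun a => ?_
        rw [lintegral_prod _ (by fun_prop)]
    _ ≤ ∫⁻ a, ∫⁻ c, ∫⁻ t, σ.rnDeriv lam (t - c) * ρ.rnDeriv lam (t - a) *
          (τ.rnDeriv lam t)⁻¹ ∂lam ∂C ∂A :=
        lintegral_mono fun a => lintegral_mono fun c => hmain a c
    _ = ∫⁻ a, ∫⁻ t, ρ.rnDeriv lam (t - a) * ((∫⁻ c, σ.rnDeriv lam (t - c) ∂C) *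
          (τ.rnDeriv lam t)⁻¹) ∂lam ∂A := by
        refine lintegral_congr fun a => ?_
        rw [lintegral_lintegral_swap (by fun_prop)]
        refine lintegral_congr fun t => ?_
        rw [lintegral_mul_const _ (by fun_prop), lintegral_mul_const _ (by fun_prop)]
        ring
    _ = ∫⁻ a, ∫⁻ t, ρ.rnDeriv lam (t - a) * (τ.rnDeriv lam t * (τ.rnDeriv lam t)⁻¹)
          ∂lam ∂A := by
        refine lintegral_congr fun a => lintegral_congr_ae ?_
        filter_upwards [d2] with t ht
        rw [ht]
    _ ≤ ∫⁻ a, ∫⁻ t, ρ.rnDeriv lam (t - a) ∂lam ∂A :=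
        lintegral_mono fun a => lintegral_mono fun t =>
          mul_le_of_le_one_right' (ENNReal.mul_inv_le_one _)
    _ ≤ ∫⁻ a, 1 ∂A := by
        refine lintegral_mono fun a => ?_
        rw [lintegral_sub_right_eq_self]
        exact lintegral_rnDeriv_le_one
    _ = 1 := by simp

variable [lam.IsNegInvariant]

/-- With `A`, `C`, `M` independent, `T = (mc + r)A + C`, `S = mA - M` and
`V = rA + cM + C = T - cS`, one has `h(T) + h(M) ≤ h(S) + h(V)`. -/
theorem lawEntropy_dilate_conv_add_le (A C M : Measure G) [IsProbabilityMeasure A]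
    [IsProbabilityMeasure C] [IsProbabilityMeasure M] (m c r : ℤ)
    (hM : FiniteLawEntropy lam M)
    (hS : FiniteLawEntropy lam (dilate m A ∗ dilate (-1) M))
    (hV : FiniteLawEntropy lam (dilate r A ∗ dilate c M ∗ C))
    (hT : LowerLawEntropy lam (dilate (m * c + r) A ∗ C)) :
    FiniteLawEntropy lam (dilate (m * c + r) A ∗ C) ∧
      lawEntropy lam (dilate (m * c + r) A ∗ C) + lawEntropy lam M ≤
        lawEntropy lam (dilate m A ∗ dilate (-1) M) +
          lawEntropy lam (dilate r A ∗ dilate c M ∗ C) := by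
  have eX : (A.prod (C.prod M)).map (fun p => p.2.2) = M := by
    refine Measure.ext_of_lintegral _ fun f hf => ?_
    rw [lintegral_map hf (by fun_prop), lintegral_prod _ (by fun_prop)]
    simp_rw [lintegral_prod (μ := C) (ν := M) _
      (by fun_prop : AEMeasurable (fun q : G × G => f q.2) _)]
    simp
  have eS : (A.prod (C.prod M)).map (fun p => m • p.1 - p.2.2) = dilate m A ∗ dilate (-1) M := by
    refine Measure.ext_of_lintegral _ fun f hf => ?_
    unfold dilate
    rw [lintegral_map hf (by fun_prop), lintegral_prod _ (by fun_prop),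
      Measure.lintegral_conv hf, lintegral_map (by fun_prop) (by fun_prop)]
    refine lintegral_congr fun a => ?_
    rw [lintegral_prod _ (by fun_prop), lintegral_map (by fun_prop) (by fun_prop)]
    simp [sub_eq_add_neg]
  have eV : (A.prod (C.prod M)).map (fun p => r • p.1 + (c • p.2.2 + p.2.1)) =
      dilate r A ∗ dilate c M ∗ C := by
    refine Measure.ext_of_lintegral _ fun f hf => ?_
    unfold dilate
    rw [lintegral_map hf (by fun_prop), lintegral_prod _ (by fun_prop),
      Measure.lintegral_conv hf, lintegral_map (by fun_prop) (by fun_prop)]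
    refine lintegral_congr fun a => ?_
    rw [lintegral_prod_symm _ (by fun_prop), Measure.lintegral_conv (by fun_prop),
      lintegral_map (by fun_prop) (by fun_prop)]
  have eT : (A.prod (C.prod M)).map (fun p => (m * c + r) • p.1 + p.2.1) =
      dilate (m * c + r) A ∗ C := by
    refine Measure.ext_of_lintegral _ fun f hf => ?_
    unfold dilate
    rw [lintegral_map hf (by fun_prop), lintegral_prod _ (by fun_prop),
      Measure.lintegral_conv hf, lintegral_map (by fun_prop) (by fun_prop)]
    refine lintegral_congr fun a => ?_
    rw [lintegral_prod _ (by fun_prop)]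
    simp
  have key := entropy_add_le_of_lintegral_ratio_le_one (lam := lam) (π := A.prod (C.prod M))
    (S := fun p => m • p.1 - p.2.2) (V := fun p => r • p.1 + (c • p.2.2 + p.2.1))
    (X := fun p => p.2.2) (T := fun p => (m * c + r) • p.1 + p.2.1)
    (by fun_prop) (by fun_prop) (by fun_prop) (by fun_prop)
  rw [eS, eV, eX, eT] at key
  refine key hS hV hM hT ?_
  set σ := dilate m A ∗ dilate (-1) M
  set ρ := dilate r A ∗ dilate c M ∗ C
  set τ := dilate (m * c + r) A ∗ C
  have hτ : IsProbabilityMeasure τ := inferInstance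
  have hmain : ∀ a y : G, ∫⁻ x, σ.rnDeriv lam (m • a - x) * ρ.rnDeriv lam (r • a + (c • x + y)) *
      (M.rnDeriv lam x)⁻¹ * (τ.rnDeriv lam ((m * c + r) • a + y))⁻¹ ∂M ≤
      (∫⁻ s, σ.rnDeriv lam s * ρ.rnDeriv lam ((m * c + r) • a + y - c • s) ∂lam) *
        (τ.rnDeriv lam ((m * c + r) • a + y))⁻¹ := by
    intro a y
    rw [lintegral_mul_const _ (by fun_prop)]
    refine mul_le_mul' ?_ le_rfl
    refine (lintegral_mul_inv_rnDeriv_le hM.ac (F := fun x => σ.rnDeriv lam (m • a - x) *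
      ρ.rnDeriv lam (r • a + (c • x + y))) (by fun_prop)).trans_eq ?_
    -- Substituting `s = ma - x` turns `ra + cx + y` into `(mc + r)a + y - cs`, so `a` and `y` enter
    -- only through the value of `T`.
    rw [← lintegral_sub_left_eq_self _ (m • a)]
    refine lintegral_congr fun x => ?_
    congr 2
    · abel
    · rw [smul_sub, smul_smul, mul_comm c m, add_smul]; abel
  have hΦ : Measurable fun t => ∫⁻ s, σ.rnDeriv lam s * ρ.rnDeriv lam (t - c • s) ∂lam :=
    Measurable.lintegral_prod_right' (f := fun p : G × G =>
      σ.rnDeriv lam p.2 * ρ.rnDeriv lam (p.1 - c • p.2)) (by fun_prop)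
  calc _ = ∫⁻ a, ∫⁻ y, ∫⁻ x, σ.rnDeriv lam (m • a - x) *
        ρ.rnDeriv lam (r • a + (c • x + y)) * (M.rnDeriv lam x)⁻¹ *
        (τ.rnDeriv lam ((m * c + r) • a + y))⁻¹ ∂M ∂C ∂A := by
        rw [lintegral_prod _ (by fun_prop)]
        refine lintegral_congr fun a => ?_
        rw [lintegral_prod _ (by fun_prop)]
    _ ≤ ∫⁻ a, ∫⁻ y, (∫⁻ s, σ.rnDeriv lam s *
          ρ.rnDeriv lam ((m * c + r) • a + y - c • s) ∂lam) *
        (τ.rnDeriv lam ((m * c + r) • a + y))⁻¹ ∂C ∂A :=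
        lintegral_mono fun a => lintegral_mono fun y => hmain a y
    -- The integrals over `A` and `C` combine into one over the law `τ` of `T`, whose density then
    -- cancels. No density of a dilate alone is needed.
    _ = ∫⁻ t, (∫⁻ s, σ.rnDeriv lam s * ρ.rnDeriv lam (t - c • s) ∂lam) *
        (τ.rnDeriv lam t)⁻¹ ∂τ := by
        have hΨ : Measurable fun t => (∫⁻ s, σ.rnDeriv lam s *
            ρ.rnDeriv lam (t - c • s) ∂lam) * (τ.rnDeriv lam t)⁻¹ :=
          hΦ.mul (Measure.measurable_rnDeriv τ lam).inv
        rw [Measure.lintegral_conv hΨ]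
        exact (lintegral_map (hΨ.comp measurable_add).lintegral_prod_right' (by fun_prop)).symm
    _ ≤ ∫⁻ t, ∫⁻ s, σ.rnDeriv lam s * ρ.rnDeriv lam (t - c • s) ∂lam ∂lam :=
        lintegral_mul_inv_rnDeriv_le hT.ac hΦ
    _ = ∫⁻ s, ∫⁻ t, σ.rnDeriv lam s * ρ.rnDeriv lam (t - c • s) ∂lam ∂lam :=
        lintegral_lintegral_swap (by fun_prop)
    _ ≤ ∫⁻ s, σ.rnDeriv lam s ∂lam := by
        refine lintegral_mono fun s => ?_
        rw [lintegral_const_mul _ (by fun_prop), lintegral_sub_right_eq_self]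
        exact mul_le_of_le_one_right' lintegral_rnDeriv_le_one
    _ ≤ 1 := lintegral_rnDeriv_le_one

end Group

/-! ### Doubling constants and binary expansion. -/

section Chain

variable {G : Type*} [AddCommGroup G] [MeasurableSpace G] [MeasurableAdd₂ G]

theorem conv_left_comm (A B C : Measure G) [SFinite A] [SFinite B] [SFinite C] :
    A ∗ B ∗ C = B ∗ A ∗ C := by
  rw [← Measure.conv_assoc, Measure.conv_comm A B, Measure.conv_assoc]

variable [MeasurableNeg G] {lam : Measure G} [SigmaFinite lam] [lam.IsAddLeftInvariant]
  {μ ν : Measure G} [IsProbabilityMeasure μ] [IsProbabilityMeasure ν]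

/-- `h(X + X') - h(X) ≤ 2h(X + Y) - h(X) - h(Y)`. -/
theorem lawEntropy_conv_self_le (hμ : FiniteLawEntropy lam μ) (hν : FiniteLawEntropy lam ν)
    (hμν : FiniteLawEntropy lam (μ ∗ ν)) :
    FiniteLawEntropy lam (μ ∗ μ) ∧ lawEntropy lam (μ ∗ μ) ≤
      lawEntropy lam μ + (2 * lawEntropy lam (μ ∗ ν) - lawEntropy lam μ - lawEntropy lam ν) := by
  have hνμ := hμν
  rw [Measure.conv_comm] at hνμ
  have key := lawEntropy_conv_conv_add_le μ ν μ hν hμν hνμ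
  rw [Measure.conv_comm ν μ, ← Measure.conv_assoc] at key
  rw [Measure.conv_assoc, conv_left_comm, Measure.conv_comm μ (μ ∗ ν), Measure.conv_assoc,
    Measure.conv_comm ν μ, ← Measure.conv_assoc] at key
  have hf := (hμ.lower_conv μ).finite_of_conv key.1
  refine ⟨hf, ?_⟩
  -- `h(X + X') ≤ h(X + X' + Y) ≤ 2h(X + Y) - h(Y)`.
  have := lawEntropy_le_conv hf key.1
  linarith [key.2]

variable {D : ℝ}

/-- Cost of one digit: trivial for `r = 0`; for `r = ±1` it is submodularity with the copy of `X`
already present as the common middle term. -/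
theorem lawEntropy_digit_conv_le (hD : 0 ≤ D) (hμ : FiniteLawEntropy lam μ)
    (hadd : FiniteLawEntropy lam (μ ∗ μ)) (hadd_le : lawEntropy lam (μ ∗ μ) ≤ lawEntropy lam μ + D)
    (hsub : FiniteLawEntropy lam (μ ∗ dilate (-1) μ))
    (hsub_le : lawEntropy lam (μ ∗ dilate (-1) μ) ≤ lawEntropy lam μ + D)
    {r : ℤ} (hr : r.natAbs ≤ 1) (ζ : Measure G) [IsProbabilityMeasure ζ]
    (hζ : FiniteLawEntropy lam (μ ∗ ζ)) :
    FiniteLawEntropy lam (dilate r μ ∗ μ ∗ ζ) ∧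
      lawEntropy lam (dilate r μ ∗ μ ∗ ζ) ≤ lawEntropy lam (μ ∗ ζ) + D := by
  have hcomm : dilate r μ ∗ μ ∗ ζ = ζ ∗ μ ∗ dilate r μ := by
    rw [Measure.conv_comm μ ζ, conv_left_comm, Measure.conv_comm μ]
  have hr' : r = 0 ∨ r = 1 ∨ r = -1 := by omega
  have hζ' := hζ
  rw [Measure.conv_comm] at hζ'
  have hkv (h : FiniteLawEntropy lam (μ ∗ dilate r μ))
      (hle : lawEntropy lam (μ ∗ dilate r μ) ≤ lawEntropy lam μ + D) :
      FiniteLawEntropy lam (dilate r μ ∗ μ ∗ ζ) ∧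
        lawEntropy lam (dilate r μ ∗ μ ∗ ζ) ≤ lawEntropy lam (μ ∗ ζ) + D := by
    rw [hcomm, Measure.conv_comm μ ζ]
    have key := lawEntropy_conv_conv_add_le ζ μ (dilate r μ) hμ hζ' h
    exact ⟨key.1, by linarith [key.2]⟩
  rcases hr' with rfl | rfl | rfl
  · rw [dilate_zero, Measure.dirac_zero_conv]
    exact ⟨hζ, by linarith⟩
  · exact hkv (by rwa [dilate_one]) (by rwa [dilate_one])
  · exact hkv hsub hsub_le

variable [lam.IsNegInvariant]

/-- `h(X - X') - h(X) ≤ 2h(X + Y) - h(X) - h(Y)`. -/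
theorem lawEntropy_conv_neg_self_le (hμ : FiniteLawEntropy lam μ) (hν : FiniteLawEntropy lam ν)
    (hμν : FiniteLawEntropy lam (μ ∗ ν)) :
    FiniteLawEntropy lam (μ ∗ dilate (-1) μ) ∧ lawEntropy lam (μ ∗ dilate (-1) μ) ≤
      lawEntropy lam μ + (2 * lawEntropy lam (μ ∗ ν) - lawEntropy lam μ - lawEntropy lam ν) := by
  have hneg := lawEntropy_dilate_neg_one hν
  have hneg2 := lawEntropy_dilate_neg_one hμν
  rw [dilate_conv, Measure.conv_comm] at hneg2
  -- Ruzsa's triangle inequality with `M = -Y`: `S` is distributed as `X + Y` and `V` as `-(X + Y)`.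
  have key := lawEntropy_dilate_conv_add_le (lam := lam) μ (dilate (-1) μ) (dilate (-1) ν) 1 1 0
    hneg.1
  have e1 : (-1 : ℤ) * -1 = 1 := by norm_num
  have e2 : (1 : ℤ) * 1 + 0 = 1 := by norm_num
  rw [dilate_dilate, e1, e2, dilate_one, dilate_one, dilate_one, dilate_zero,
    Measure.dirac_zero_conv] at key
  have := key hμν hneg2.1 (hμ.lower_conv _)
  refine ⟨this.1, ?_⟩
  have h2 := this.2
  rw [hneg.2, hneg2.2] at h2
  linarith

/-- `h(2X - X') - h(X)` is at most three times the doubling constant `D`. -/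
theorem lawEntropy_double_sub_le (hD : 0 ≤ D) (hμ : FiniteLawEntropy lam μ)
    (hadd : FiniteLawEntropy lam (μ ∗ μ)) (hadd_le : lawEntropy lam (μ ∗ μ) ≤ lawEntropy lam μ + D)
    (hsub : FiniteLawEntropy lam (μ ∗ dilate (-1) μ))
    (hsub_le : lawEntropy lam (μ ∗ dilate (-1) μ) ≤ lawEntropy lam μ + D) :
    FiniteLawEntropy lam (dilate 2 μ ∗ dilate (-1) μ) ∧
      lawEntropy lam (dilate 2 μ ∗ dilate (-1) μ) ≤ lawEntropy lam μ + 3 * D := by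
  have hV := lawEntropy_digit_conv_le hD hμ hadd hadd_le hsub hsub_le (r := -1) (by simp) μ hadd
  rw [Measure.conv_comm (dilate (-1) μ), Measure.conv_assoc] at hV
  -- Here `S = X - X'` costs `D` and `V = X + X' - X''` costs `2D`.
  have key := lawEntropy_dilate_conv_add_le (lam := lam) μ (dilate (-1) μ) μ 1 1 1 hμ
  have e2 : (1 : ℤ) * 1 + 1 = 2 := by norm_num
  rw [e2, dilate_one] at key
  have hT : LowerLawEntropy lam (dilate 2 μ ∗ dilate (-1) μ) := by
    rw [Measure.conv_comm]
    exact (lawEntropy_dilate_neg_one hμ).1.lower_conv _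
  have := key hsub hV.1 hT
  exact ⟨this.1, by linarith [this.2, hV.2]⟩

/-- Adding `aX` to a sum which already contains a copy of `X` increases the entropy by at most
`4k + 1` times the doubling constant, where `k + 1` is the number of binary digits of `a`. -/
theorem lawEntropy_dilate_conv_le (hD : 0 ≤ D) (hμ : FiniteLawEntropy lam μ)
    (hadd : FiniteLawEntropy lam (μ ∗ μ)) (hadd_le : lawEntropy lam (μ ∗ μ) ≤ lawEntropy lam μ + D)
    (hsub : FiniteLawEntropy lam (μ ∗ dilate (-1) μ))
    (hsub_le : lawEntropy lam (μ ∗ dilate (-1) μ) ≤ lawEntropy lam μ + D)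
    (k : ℕ) (a : ℤ) (ha : a.natAbs < 2 ^ (k + 1)) (ζ : Measure G) [IsProbabilityMeasure ζ]
    (hζ : FiniteLawEntropy lam (μ ∗ ζ)) :
    FiniteLawEntropy lam (dilate a μ ∗ μ ∗ ζ) ∧
      lawEntropy lam (dilate a μ ∗ μ ∗ ζ) ≤ lawEntropy lam (μ ∗ ζ) + (4 * k + 1) * D := by
  induction k generalizing a ζ with
  | zero =>
    have := lawEntropy_digit_conv_le hD hμ hadd hadd_le hsub hsub_le (r := a)
      (by simp at ha; omega) ζ hζ
    simpa using this
  | succ k ih =>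
    obtain ⟨c, r, rfl, hr, hc⟩ :
        ∃ c r : ℤ, a = 2 * c + r ∧ r.natAbs ≤ 1 ∧ c.natAbs < 2 ^ (k + 1) := by
      rw [pow_succ] at ha
      -- Division must truncate towards zero: floor division of a negative `a` could break the bound
      -- on `|c|`.
      rcases le_total 0 a with h0 | h0
      · exact ⟨a / 2, a % 2, by omega, by omega, by omega⟩
      · exact ⟨-(-a / 2), -(-a % 2), by omega, by omega, by omega⟩
    have hdigit := lawEntropy_digit_conv_le hD hμ hadd hadd_le hsub hsub_le hr ζ hζ
    rw [conv_left_comm] at hdigit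
    have hV := ih c hc (dilate r μ ∗ ζ) hdigit.1
    rw [conv_left_comm μ (dilate r μ) ζ, conv_left_comm (dilate c μ)] at hV
    have hdouble := lawEntropy_double_sub_le hD hμ hadd hadd_le hsub hsub_le
    have hT : LowerLawEntropy lam (dilate (2 * c + r) μ ∗ μ ∗ ζ) := by
      rw [conv_left_comm]
      exact hμ.lower_conv _
    -- Total cost: `3D` for `2X - X'`, `D` for the digit `r`, and `(4k + 1)D` for `c` by induction.
    have key := lawEntropy_dilate_conv_add_le (lam := lam) μ (μ ∗ ζ) μ 2 c r hμ hdouble.1 hV.1 hT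
    refine ⟨key.1, ?_⟩
    have h1 := hdigit.2
    rw [conv_left_comm μ (dilate r μ) ζ] at h1
    have h2 := hV.2
    push_cast
    linarith [key.2, hdouble.2]

end Chain

/-- Passes from binary to natural logarithms: `log 2 > 2/3` gives `2k < 3(⌊log|a|⌋ + 1)`, and
strictness between integers supplies the `+ 1`. Doubled, this yields the factor `6`. -/
theorem two_mul_log_two_add_one_le (a : ℤ) :
    2 * (Nat.log 2 a.natAbs : ℝ) + 1 ≤ 3 * ((⌊Real.log |(a : ℝ)|⌋ : ℝ) + 1) := by
  rcases eq_or_ne a 0 with rfl | ha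
  · norm_num
  set k := Nat.log 2 a.natAbs
  have hk : (2 : ℝ) ^ k ≤ |(a : ℝ)| := by
    have h := Nat.pow_log_le_self 2 (Int.natAbs_ne_zero.2 ha)
    rw [← Int.cast_abs, Int.abs_eq_natAbs]
    exact_mod_cast h
  have hlog : k * Real.log 2 ≤ Real.log |(a : ℝ)| := by
    rw [← Real.log_pow]
    exact Real.log_le_log (by positivity) hk
  have hfl := Int.lt_floor_add_one (Real.log |(a : ℝ)|)
  have h2 := Real.log_two_gt_d9
  have hk0 : (0 : ℝ) ≤ k := Nat.cast_nonneg k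
  have hlt : 2 * (k : ℝ) < 3 * ((⌊Real.log |(a : ℝ)|⌋ : ℝ) + 1) := by nlinarith
  have : 2 * (k : ℤ) < 3 * (⌊Real.log |(a : ℝ)|⌋ + 1) := by exact_mod_cast hlt
  have : 2 * (k : ℤ) + 1 ≤ 3 * (⌊Real.log |(a : ℝ)|⌋ + 1) := by omega
  exact_mod_cast this

/-! ### The bound for integer weights. -/

section Chain

variable {G : Type*} [AddCommGroup G] [MeasurableSpace G] [MeasurableAdd₂ G]
  [MeasurableNeg G] {lam : Measure G} [SigmaFinite lam] [lam.IsAddLeftInvariant]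
  [lam.IsNegInvariant] {μ ν : Measure G} [IsProbabilityMeasure μ] [IsProbabilityMeasure ν]

theorem lawEntropy_weighted_sum_le (hμ : FiniteLawEntropy lam μ) (hν : FiniteLawEntropy lam ν)
    (hμν : FiniteLawEntropy lam (μ ∗ ν)) (a b : ℤ)
    (hab : FiniteLawEntropy lam (dilate a μ ∗ dilate b ν)) :
    lawEntropy lam (dilate a μ ∗ dilate b ν) - lawEntropy lam (μ ∗ ν) ≤
      6 * ((⌊Real.log |(a : ℝ)|⌋ : ℝ) + (⌊Real.log |(b : ℝ)|⌋ : ℝ) + 2) *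
        (2 * lawEntropy lam (μ ∗ ν) - lawEntropy lam μ - lawEntropy lam ν) := by
  have hνμ := hμν
  rw [Measure.conv_comm] at hνμ
  have hle1 := lawEntropy_le_conv hμ hμν
  have hle2 := lawEntropy_le_conv hν hνμ
  have hself := lawEntropy_conv_self_le hμ hν hμν
  have hneg := lawEntropy_conv_neg_self_le hμ hν hμν
  have hself' := lawEntropy_conv_self_le hν hμ hνμ
  have hneg' := lawEntropy_conv_neg_self_le hν hμ hνμ
  rw [Measure.conv_comm ν μ] at hle2 hself' hneg'
  rw [sub_right_comm] at hself' hneg'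
  set D := 2 * lawEntropy lam (μ ∗ ν) - lawEntropy lam μ - lawEntropy lam ν
  have hD : 0 ≤ D := by simp only [D]; linarith
  have h1 := lawEntropy_dilate_conv_le hD hμ hself.1 hself.2 hneg.1 hneg.2
    (Nat.log 2 a.natAbs) a (Nat.lt_pow_succ_log_self one_lt_two _) ν hμν
  have e1 : dilate a μ ∗ μ ∗ ν = ν ∗ dilate a μ ∗ μ := by
    rw [Measure.conv_comm μ ν, conv_left_comm]
  rw [e1] at h1
  have h2 := lawEntropy_dilate_conv_le hD hν hself'.1 hself'.2 hneg'.1 hneg'.2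
    (Nat.log 2 b.natAbs) b (Nat.lt_pow_succ_log_self one_lt_two _) (dilate a μ ∗ μ) h1.1
  have e2 : dilate b ν ∗ ν ∗ dilate a μ ∗ μ = (dilate a μ ∗ dilate b ν) ∗ μ ∗ ν := by
    rw [← e1, conv_left_comm, Measure.conv_assoc]
  rw [e2] at h2
  -- The auxiliary copies of `X` and `Y` are discarded by monotonicity.
  have h3 := lawEntropy_le_conv hab h2.1
  have ka := two_mul_log_two_add_one_le a
  have kb := two_mul_log_two_add_one_le b
  have hk : ((4 * (Nat.log 2 a.natAbs : ℝ) + 1) + (4 * (Nat.log 2 b.natAbs : ℝ) + 1)) * D ≤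
      6 * ((⌊Real.log |(a : ℝ)|⌋ : ℝ) + (⌊Real.log |(b : ℝ)|⌋ : ℝ) + 2) * D := by
    gcongr
    linarith
  linarith [h1.2, h2.2]

end Chain

/-! ### From random variables to laws. -/

section RandomVariables

variable {G Ω : Type*} [AddCommGroup G] [MeasurableSpace G] [MeasurableAdd₂ G]
  [MeasurableNeg G] [MeasurableSpace Ω]

theorem map_fst_sub_snd_prod (μ ν : Measure G) [IsProbabilityMeasure μ]
    [IsProbabilityMeasure ν] :
    (μ.prod ν).map (fun p => p.1 - p.2) = μ ∗ dilate (-1) ν := by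
  refine Measure.ext_of_lintegral _ fun f hf => ?_
  rw [lintegral_map hf (by fun_prop), lintegral_prod _ (by fun_prop), Measure.lintegral_conv hf]
  refine lintegral_congr fun x => ?_
  rw [dilate, lintegral_map (by fun_prop) (by fun_prop)]
  simp [sub_eq_add_neg]

theorem map_zsmul_eq_dilate {P : Measure Ω} {X : Ω → G} (hX : Measurable X) (n : ℤ) :
    P.map (fun ω => n • X ω) = dilate n (P.map X) := by
  rw [dilate, Measure.map_map (by fun_prop) hX]
  rfl

theorem map_neg_eq_dilate {P : Measure Ω} {X : Ω → G} (hX : Measurable X) :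
    P.map (fun ω => -X ω) = dilate (-1) (P.map X) := by
  simpa using map_zsmul_eq_dilate (P := P) hX (-1)

theorem map_fun_add_eq_conv {G Ω : Type*} [AddCommGroup G] [MeasurableSpace G]
    [MeasurableAdd₂ G] [MeasurableSpace Ω] {P : Measure Ω} [IsProbabilityMeasure P] {X Y : Ω → G}
    (hX : Measurable X) (hY : Measurable Y) (h : IndepFun X Y P) :
    P.map (fun ω => X ω + Y ω) = P.map X ∗ P.map Y :=
  h.map_add_eq_map_conv_map hX hY

theorem ruzsaDivergence_eq {lam : Measure G} [SigmaFinite lam] {P : Measure Ω}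
    [IsProbabilityMeasure P] {X Y : Ω → G} (hX : Measurable X) (hY : Measurable Y)
    (h : P.map X ≪ lam) (hXY : P.map X ∗ dilate (-1) (P.map Y) ≪ lam) :
    ruzsaDivergence lam P X Y =
      lawEntropy lam (P.map X ∗ dilate (-1) (P.map Y)) - lawEntropy lam (P.map X) := by
  have := Measure.isProbabilityMeasure_map (μ := P) hX.aemeasurable
  have := Measure.isProbabilityMeasure_map (μ := P) hY.aemeasurable
  rw [← map_fst_sub_snd_prod] at hXY ⊢
  rw [ruzsaDivergence, haarEntropy_eq_lawEntropy hXY, haarEntropy_eq_lawEntropy h]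

end RandomVariables

theorem theorem4p5 {G : Type*} [AddCommGroup G] [TopologicalSpace G] [IsTopologicalAddGroup G]
    [PolishSpace G] [LocallyCompactSpace G] [MeasurableSpace G] [BorelSpace G]
    (lam : Measure G) [lam.IsAddHaarMeasure]
    {Ω : Type*} [MeasurableSpace Ω] (P : Measure Ω) [IsProbabilityMeasure P] :
    -- the bound for weighted sums (here `Real.log |0| = 0`, so `⌊log |0|⌋` is read as `0`)
    (∀ X Y : Ω → G, Measurable X → Measurable Y → IndepFun X Y P → ∀ a b : ℤ,
      HasFiniteHaarEntropy lam P X → HasFiniteHaarEntropy lam P Y →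
      HasFiniteHaarEntropy lam P (fun ω => X ω + Y ω) →
      HasFiniteHaarEntropy lam P (fun ω => a • X ω + b • Y ω) →
      haarEntropy lam P (fun ω => a • X ω + b • Y ω) - haarEntropy lam P (fun ω => X ω + Y ω)
        ≤ 6 * ((⌊Real.log |(a : ℝ)|⌋ : ℝ) + (⌊Real.log |(b : ℝ)|⌋ : ℝ) + 2) *
          (ruzsaDivergence lam P X (fun ω => -Y ω) + ruzsaDivergence lam P Y (fun ω => -X ω))) ∧
    -- the two one-step inequalities
    (∀ X X' Z : Ω → G, Measurable X → Measurable X' → Measurable Z →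
      iIndepFun ![X, X', Z] P → IdentDistrib X X' P P → ∀ a b : ℤ, a ≠ 0 → b ≠ 0 →
      HasFiniteHaarEntropy lam P X →
      HasFiniteHaarEntropy lam P (fun ω => a • X ω + Z ω) →
      (HasFiniteHaarEntropy lam P (fun ω => X ω - X' ω) →
        HasFiniteHaarEntropy lam P (fun ω => (a - b) • X ω + b • X' ω + Z ω) →
        haarEntropy lam P (fun ω => a • X ω + Z ω)
          ≤ haarEntropy lam P (fun ω => (a - b) • X ω + b • X' ω + Z ω)
            + ruzsaDivergence lam P X X) ∧
      (Even a →
        HasFiniteHaarEntropy lam P (fun ω => (2 : ℤ) • X ω - X' ω) →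
        HasFiniteHaarEntropy lam P (fun ω => (a / 2) • X ω + Z ω) →
        haarEntropy lam P (fun ω => a • X ω + Z ω)
          ≤ haarEntropy lam P (fun ω => (a / 2) • X ω + Z ω)
            + haarEntropy lam P (fun ω => (2 : ℤ) • X ω - X' ω) - haarEntropy lam P X)) := by
  refine ⟨fun X Y hX hY hXY a b fX fY fXY fab => ?_,
    fun X X' Z hX hX' hZ hind hid a b _ _ fX fT => ?_⟩
  · have := Measure.isProbabilityMeasure_map (μ := P) hX.aemeasurable
    have := Measure.isProbabilityMeasure_map (μ := P) hY.aemeasurable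
    have eXY := map_fun_add_eq_conv hX hY hXY
    have eab : P.map (fun ω => a • X ω + b • Y ω) =
        dilate a (P.map X) ∗ dilate b (P.map Y) := by
      rw [map_fun_add_eq_conv (X := fun ω => a • X ω) (Y := fun ω => b • Y ω) (by fun_prop)
        (by fun_prop) (hXY.comp (φ := fun x : G => a • x) (ψ := fun x : G => b • x) (by fun_prop) (by fun_prop)),
        map_zsmul_eq_dilate hX, map_zsmul_eq_dilate hY]
    have dneg : ∀ W : Ω → G, Measurable W →
        dilate (-1) (P.map (fun ω => -W ω)) = P.map W := fun W hW => by
      rw [map_neg_eq_dilate hW, dilate_dilate]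
      exact dilate_one _
    rw [hasFiniteHaarEntropy_iff] at fX fY fXY fab
    rw [haarEntropy_eq_lawEntropy fXY.ac, haarEntropy_eq_lawEntropy fab.ac]
    rw [eXY] at fXY
    rw [eab] at fab
    have fYX := fXY
    rw [Measure.conv_comm] at fYX
    have key := lawEntropy_weighted_sum_le fX fY fXY a b fab
    rw [ruzsaDivergence_eq hX (by fun_prop) fX.ac (by rw [dneg Y hY]; exact fXY.ac),
      ruzsaDivergence_eq hY (by fun_prop) fY.ac (by rw [dneg X hX]; exact fYX.ac),
      dneg X hX, dneg Y hY, eXY, eab, Measure.conv_comm (P.map Y)]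
    -- The two negations cancel, so the divergences sum to `2h(X + Y) - h(X) - h(Y)`.
    refine key.trans_eq ?_
    ring
  · have := Measure.isProbabilityMeasure_map (μ := P) hX.aemeasurable
    have := Measure.isProbabilityMeasure_map (μ := P) hZ.aemeasurable
    have hmeas : ∀ i, Measurable (![X, X', Z] i) := by
      intro i; fin_cases i <;> assumption
    have iXX' : IndepFun X X' P := by simpa using hind.indepFun (i := 0) (j := 1) (by decide)
    have iXZ : IndepFun X Z P := by simpa using hind.indepFun (i := 0) (j := 2) (by decide)
    have iX'Z : IndepFun X' Z P := by simpa using hind.indepFun (i := 1) (j := 2) (by decide)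
    have iXXZ : IndepFun (fun ω => (X' ω, Z ω)) X P := by
      simpa using hind.indepFun_prodMk hmeas 1 2 0 (by decide) (by decide)
    have eX' : P.map X' = P.map X := hid.map_eq.symm
    have eadd : ∀ n : ℤ, P.map (fun ω => n • X ω + Z ω) = dilate n (P.map X) ∗ P.map Z := by
      intro n
      rw [map_fun_add_eq_conv (X := fun ω => n • X ω) (Y := Z) (by fun_prop) hZ
        (iXZ.comp (φ := fun x : G => n • x) (ψ := id) (by fun_prop) measurable_id),
        map_zsmul_eq_dilate hX]
    have esub : ∀ n : ℤ, P.map (fun ω => n • X ω - X' ω) =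
        dilate n (P.map X) ∗ dilate (-1) (P.map X) := by
      intro n
      simp only [sub_eq_add_neg]
      rw [map_fun_add_eq_conv (X := fun ω => n • X ω) (Y := fun ω => -X' ω) (by fun_prop)
        (by fun_prop) (iXX'.comp (φ := fun x : G => n • x) (ψ := fun x => -x) (by fun_prop) (by fun_prop)),
        map_zsmul_eq_dilate hX, map_neg_eq_dilate hX', eX']
    have eV : ∀ m n : ℤ, P.map (fun ω => m • X ω + n • X' ω + Z ω) =
        dilate m (P.map X) ∗ dilate n (P.map X) ∗ P.map Z := by
      intro m n
      simp only [add_assoc]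
      rw [map_fun_add_eq_conv (X := fun ω => m • X ω) (Y := fun ω => n • X' ω + Z ω) (by fun_prop)
        (by fun_prop) (iXXZ.symm.comp (φ := fun x : G => m • x) (ψ := fun p : G × G => n • p.1 + p.2)
          (by fun_prop) (by fun_prop)),
        map_zsmul_eq_dilate hX, map_fun_add_eq_conv (X := fun ω => n • X' ω) (Y := Z) (by fun_prop) hZ
        (iX'Z.comp (φ := fun x : G => n • x) (ψ := id) (by fun_prop) measurable_id),
        map_zsmul_eq_dilate hX', eX']
    rw [hasFiniteHaarEntropy_iff] at fX fT
    rw [haarEntropy_eq_lawEntropy fT.ac]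
    rw [eadd a] at fT ⊢
    refine ⟨fun fS fV => ?_, fun ha fS fV => ?_⟩
    · rw [hasFiniteHaarEntropy_iff] at fS fV
      rw [haarEntropy_eq_lawEntropy fV.ac]
      have e1 : P.map (fun ω => X ω - X' ω) = P.map X ∗ dilate (-1) (P.map X) := by
        simpa [dilate_one] using esub 1
      rw [e1] at fS
      rw [eV] at fV ⊢
      rw [ruzsaDivergence_eq hX hX fX.ac fS.ac]
      have key := lawEntropy_dilate_conv_add_le (lam := lam) (P.map X) (P.map Z) (P.map X)
        1 b (a - b) fX
      rw [dilate_one, one_mul, add_sub_cancel] at key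
      linarith [(key fS fV fT.lower).2]
    · rw [hasFiniteHaarEntropy_iff] at fS fV
      rw [haarEntropy_eq_lawEntropy fV.ac, haarEntropy_eq_lawEntropy fS.ac,
        haarEntropy_eq_lawEntropy fX.ac]
      rw [esub] at fS ⊢
      rw [eadd] at fV ⊢
      -- With `r = 0` the variable `V` is distributed as `(a/2)X + Z`; evenness gives `2 * (a / 2) =
      -- a`.
      have key := lawEntropy_dilate_conv_add_le (lam := lam) (P.map X) (P.map Z) (P.map X)
        2 (a / 2) 0 fX
      rw [dilate_zero, Measure.dirac_zero_conv, add_zero, Int.mul_ediv_cancel' ha.two_dvd] at key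
      linarith [(key fS fV fT.lower).2]
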